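/- Let $C$ be an algebraically closed field of characteristic zero, and let $C(x)[D]$ be the ring of linear differential operators $\ell_0+\ell_1D+\cdots+\ell_rD^r$ with rational function coefficients, acting on differential ring extensions of $(C(x),d/dx)$. For $L\in C(x)[D]$ let $V(L)$ be its solution space in $C((x))$. For nonzero $L_1,L_2$, the symmetric product $L_1\otimes L_2$ is the primitive operator (coprime coefficients in $C[x]$, unique up to a nonzero constant) of lowest order such that $(L_1\otimes L_2)\cdot(f_1f_2)=0$ whenever $L_1\cdot f_1=0$ and $L_2\cdot f_2=0$ in a differential ring extension of $C(x)$; $L^{\otimes s}=L\otimes\cdots\otimes L$ ($s$ factors), with $L^{\otimes 0}=D$. For a nonzero $N\in C[x][D]$ write $N\cdot x^s=x^{s+\sigma}(p_0(s)+p_1(s)x+\cdots+p_t(s)x^t)$ with $\sigma\in\mathbb Z$, $p_i\in C[s]$, $p_0\ne0$; $p_0$ is the indicial polynomial of $N$ at $0$, and $Z_N=\{k\in\mathbb N\mid p_0(k)=0\}$. For $k\in\mathbb Z$ let $T_k:C((x))\to C((x))$, $T_k(\sum_i a_ix^i)=\sum_{i\le k}a_ix^i$. For a subspace $V$ and a subset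 $U$ of $C((x))$ let $(V:U)=\{h\in C((x))\mid hU\subseteq V\}$. **Theorem.** Let $L,M\in C(x)[D]$ have positive orders $r$ and $n$, and let $0$ be an ordinary point of both (dividing by the leading coefficient gives no coefficient with a pole at $0$). Let $g_1,\dots,g_r$ be a basis of $V(L)$ with $g_i=x^{i-1}+O(x^i)$, and $f_1,\dots,f_n$ a basis of $V(M)$ with $f_j=x^{j-1}+O(x^j)$. For $1\le i\le r$ put $W_i=(V(M):\{g_i\})\cap C[[x]]$. Let $N=M\otimes L^{\otimes(r-1)}$. Then $W_i=\operatorname{Span}_C\{f_j/g_i \mid i\le j\le n\}$ for all $i$, the set $Z_N$ has a largest element, and with $k_0=\max Z_N-\frac{r(r-1)}2$ the following holds for every integer $k>k_0$: 1. $\dim_C (V(M):V(L))=\dim_C\bigcap_{i=1}^r T_k(W_i)$; 2. $T_k\big((V(M):V(L))\big)=\bigcap_{i=1}^r T_k(W_i)$. Moreover, for these $k$ and all $i$, $$T_k(W_i)=\operatorname{Span}_C\Big\{T_k\Big(\frac{T_{k+r-1}(f_j)}{T_{k+r-1}(g_i)}\Big)\ \Big|\ i\le j\le n\Big\},$$ so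 the right-hand sides in 1 and 2 are determined by the coefficients of the $f_j$ and $g_i$ up to $x^{k+r-1}$. -/

import Mathlib

open Polynomial
open scoped RatFunc

universe u

noncomputable section

/-! ### Linear differential operators and their action -/

/-- Differential operators `ℓ₀ + ℓ₁ D + ⋯ + ℓᵣ Dʳ` with coefficients in `C(x)`, stored by their
coefficients: `L.coeff i` is the rational function `ℓᵢ` in front of `D ^ i`. The order of a nonzero
operator is `L.natDegree`. Only the coefficients and the action on functions
(`DiffOp.apply`) are used, never the commutative product of polynomials. -/
abbrev DiffOp (C : Type u) [Field C] : Type u := Polynomial (RatFunc C)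

/-- Differential operators with polynomial coefficients, i.e. elements of `C[x][D]`, stored in the
same way: `N.coeff i` is the polynomial in `x` in front of `D ^ i`. -/
abbrev PolyDiffOp (C : Type u) [Field C] : Type u := Polynomial (Polynomial C)

/-- An operator with polynomial coefficients, regarded as one with rational coefficients. -/
def PolyDiffOp.toDiffOp {C : Type u} [Field C] (N : PolyDiffOp C) : DiffOp C :=
  N.map (algebraMap C[X] (RatFunc C))

/-- The action `L · f = ∑ᵢ ℓᵢ δⁱ(f)` of an operator on a differential ring `(F, δ)` over `C(x)`. -/
def DiffOp.apply {C : Type u} [Field C] {F : Type u} [CommRing F] [Algebra (RatFunc C) F]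
    (δ : F → F) (L : DiffOp C) (f : F) : F :=
  L.sum fun i a => algebraMap (RatFunc C) F a * δ^[i] f

/-- `(F, δ)` is a differential ring extension of `(C(x), d/dx)`: `δ` is a derivation of `F` which
kills the constants and sends `x` to `1`, so that it extends `d/dx`. -/
structure ExtendsDdx (C : Type u) [Field C] {F : Type u} [CommRing F] [Algebra (RatFunc C) F]
    (δ : F → F) : Prop where
  map_add : ∀ f g, δ (f + g) = δ f + δ g
  leibniz : ∀ f g, δ (f * g) = δ f * g + f * δ g
  map_C : ∀ c : C, δ (algebraMap (RatFunc C) F (RatFunc.C c)) = 0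
  map_X : δ (algebraMap (RatFunc C) F RatFunc.X) = 1

/-- The derivation `d/dx` of the field `C((x))` of formal Laurent series. -/
def ddx (C : Type u) [Field C] : LaurentSeries C → LaurentSeries C :=
  LaurentSeries.derivative C

theorem ddx_coeff {C : Type u} [Field C] (f : LaurentSeries C) (n : ℤ) :
    (ddx C f).coeff n = ((n + 1 : ℤ) : C) * f.coeff (n + 1) := by
  simp [ddx]

/-- `C((x))` is a differential ring extension of `C(x)`. -/
theorem ddx_extendsDdx (C : Type u) [Field C] : ExtendsDdx C (ddx C) where
  map_add f g := map_add (LaurentSeries.derivative C) f g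
  leibniz f g := by
    set θ : LaurentSeries C → LaurentSeries C := fun h => HahnSeries.single 1 1 * ddx C h with hθ
    have hc : ∀ (h : LaurentSeries C) (n : ℤ), (θ h).coeff n = (n : C) * h.coeff n := by
      intro h n
      simp [hθ, HahnSeries.coeff_single_mul, ddx_coeff]
    have hs : ∀ h : LaurentSeries C, (θ h).support ⊆ h.support := by
      intro h n hn h0
      exact hn (by rw [hc, h0, mul_zero])
    have key : θ (f * g) = θ f * g + f * θ g := by
      ext n
      rw [hc, HahnSeries.coeff_add, HahnSeries.coeff_mul_left' f.isPWO_support (hs f),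
        HahnSeries.coeff_mul_right' g.isPWO_support (hs g), HahnSeries.coeff_mul, Finset.mul_sum,
        ← Finset.sum_add_distrib]
      refine Finset.sum_congr rfl fun ij hij => ?_
      have hij' : ij.1 + ij.2 = n := (Finset.mem_antidiagonal.mp hij).2.2
      rw [hc, hc, ← hij']
      push_cast
      ring
    have hne : (HahnSeries.single (1 : ℤ) (1 : C)) ≠ 0 := by simp
    apply mul_left_cancel₀ hne
    simp only [hθ] at key
    rw [key]
    ring
  map_C c := by
    ext n
    have : algebraMap (RatFunc C) (LaurentSeries C) (RatFunc.C c) = HahnSeries.C c := by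
      rw [← RatFunc.algebraMap_C, ← IsScalarTower.algebraMap_apply]
      rw [HahnSeries.algebraMap_apply', PowerSeries.algebraMap_apply']
      simp
    rw [this, ddx_coeff]
    by_cases h : n + 1 = 0
    · simp [h]
    · simp [HahnSeries.C_apply, HahnSeries.coeff_single_of_ne h]
  map_X := by
    ext n
    rw [RatFunc.coe_X, ddx_coeff]
    by_cases h : n = 0
    · simp [h]
    · simp [HahnSeries.coeff_single_of_ne, h, HahnSeries.coeff_one]

/-- The solution space `V(L)` of `L` in `C((x))`, as a `C`-vector space. -/
def solutionSpace {C : Type u} [Field C] (L : DiffOp C) : Submodule C (LaurentSeries C) where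
  carrier := {f | L.apply (ddx C) f = 0}
  add_mem' := by
    intro f g hf hg
    have h : ∀ i, (ddx C)^[i] (f + g) = (ddx C)^[i] f + (ddx C)^[i] g := fun i =>
      Function.Semiconj₂.iterate (map_add (LaurentSeries.derivative C)) i f g
    simp only [Set.mem_ofPred_eq, DiffOp.apply, Polynomial.sum] at *
    simp only [h, mul_add, Finset.sum_add_distrib, hf, hg, add_zero]
  zero_mem' := by
    have h : ∀ i, (ddx C)^[i] 0 = 0 := fun i =>
      Function.iterate_fixed (map_zero (LaurentSeries.derivative C)) i
    simp [DiffOp.apply, Polynomial.sum, h]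
  smul_mem' := by
    intro c f hf
    have h : ∀ i, (ddx C)^[i] (c • f) = c • (ddx C)^[i] f := fun i =>
      (Function.Commute.iterate_left
        (fun f => map_smul (LaurentSeries.derivative C) c f : Function.Commute (ddx C) (c • ·)) i) f
    simp only [Set.mem_ofPred_eq, DiffOp.apply, Polynomial.sum] at *
    simp only [h]
    simp only [← HahnSeries.C_mul_eq_smul, mul_left_comm _ (HahnSeries.C c), ← Finset.mul_sum, hf,
      mul_zero]

/-- `0` is an ordinary point of `L = ℓ₀ + ⋯ + ℓᵣ Dʳ`, `ℓᵣ ≠ 0`: none of the rational functions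
`ℓᵢ / ℓᵣ` has a pole at `0`. -/
def IsOrdinaryAtZero {C : Type u} [Field C] (L : DiffOp C) : Prop :=
  ∀ i, (RatFunc.denom (L.coeff i / L.leadingCoeff)).eval 0 ≠ 0

/-! ### Symmetric products -/

/-- `P · (f₁ f₂) = 0` whenever `f₁` is a solution of `L₁` and `f₂` is a solution of `L₂`, in any
differential ring extension of `C(x)`. -/
def AnnihilatesProducts {C : Type u} [Field C] (L₁ L₂ P : DiffOp C) : Prop :=
  ∀ (F : Type u) [CommRing F] [Algebra (RatFunc C) F] (δ : F → F), ExtendsDdx C δ →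
    ∀ f₁ f₂ : F, L₁.apply δ f₁ = 0 → L₂.apply δ f₂ = 0 → P.apply δ (f₁ * f₂) = 0

/-- `P` is the symmetric product of `L₁` and `L₂`: the primitive operator of lowest order which
annihilates all products of a solution of `L₁` and a solution of `L₂`. Primitive means that
the coefficients are coprime polynomials; the remaining constant factor is fixed by asking that the
polynomial in front of the highest power of `D` be monic. -/
structure IsSymProduct {C : Type u} [Field C] (L₁ L₂ : DiffOp C) (P : PolyDiffOp C) : Prop where
  isPrimitive : P.IsPrimitive
  monic_leadingCoeff : P.leadingCoeff.Monic
  annihilates : AnnihilatesProducts L₁ L₂ P.toDiffOp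
  minimal : ∀ P' : DiffOp C, P' ≠ 0 → AnnihilatesProducts L₁ L₂ P' → P.natDegree ≤ P'.natDegree

open Classical in
/-- The symmetric product `L₁ ⊗ L₂` (which exists whenever `L₁` and `L₂` are nonzero). -/
def symProduct {C : Type u} [Field C] (L₁ L₂ : DiffOp C) : PolyDiffOp C :=
  if h : ∃ P, IsSymProduct L₁ L₂ P then h.choose else 0

/-- The symmetric power `L^{⊗ s} = L ⊗ ⋯ ⊗ L`. The empty symmetric product is `D`, the neutral
element for `⊗`, whose solutions are the constants. -/
def symPower {C : Type u} [Field C] (L : DiffOp C) : ℕ → DiffOp C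
  | 0 => Polynomial.X
  | 1 => L
  | s + 2 => (symProduct (symPower L (s + 1)) L).toDiffOp

/-! ### Indicial polynomials -/

/-- For `N = ∑ aᵢⱼ xʲ Dⁱ`, the polynomial `∑ᵢ aᵢ,ᵢ₊ₘ s (s - 1) ⋯ (s - i + 1)` in `s`, i.e. the
coefficient of `x ^ (s + m)` in `N · x ^ s`; see `PolyDiffOp.coeff_apply_pow`. -/
def PolyDiffOp.shiftCoeff {C : Type u} [Field C] (N : PolyDiffOp C) (m : ℤ) : C[X] :=
  N.sum fun i a =>
    Polynomial.C (if 0 ≤ (i : ℤ) + m then a.coeff ((i : ℤ) + m).toNat else 0) * descPochhammer C i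

theorem ddx_iterate_single {C : Type u} [Field C] (s i : ℕ) :
    (ddx C)^[i] (HahnSeries.single (s : ℤ) 1) =
      HahnSeries.single ((s : ℤ) - i) ((descPochhammer C i).eval (s : C)) := by
  induction i with
  | zero => simp
  | succ i ih =>
    rw [Function.iterate_succ_apply', ih]
    simp only [ddx, LaurentSeries.derivative_apply, LaurentSeries.hasseDeriv_single]
    rw [descPochhammer_succ_eval]
    simp [sub_sub, mul_comm]

/-- `N · x ^ s = ∑ₘ (N.shiftCoeff m)(s) x ^ (s + m)`. -/
theorem PolyDiffOp.coeff_apply_pow {C : Type u} [Field C] (N : PolyDiffOp C) (s : ℕ) (m : ℤ) :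
    (N.toDiffOp.apply (ddx C) (HahnSeries.single (s : ℤ) 1)).coeff (s + m) =
      (N.shiftCoeff m).eval (s : C) := by
  have h1 : N.toDiffOp.apply (ddx C) (HahnSeries.single (s : ℤ) 1) =
      N.sum fun i a => algebraMap (RatFunc C) (LaurentSeries C) (algebraMap C[X] (RatFunc C) a) *
        (ddx C)^[i] (HahnSeries.single (s : ℤ) 1) := by
    unfold DiffOp.apply PolyDiffOp.toDiffOp
    rw [Polynomial.sum_def, Polynomial.sum_def, Polynomial.support_map_of_injective _
      (RatFunc.algebraMap_injective C)]
    simp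
  rw [h1, PolyDiffOp.shiftCoeff, Polynomial.sum_def, Polynomial.sum_def, Polynomial.eval_finsetSum,
    HahnSeries.coeff_sum]
  refine Finset.sum_congr rfl fun i _ => ?_
  rw [ddx_iterate_single, HahnSeries.coeff_mul_single, Polynomial.eval_mul, Polynomial.eval_C]
  congr 1
  rw [← IsScalarTower.algebraMap_apply, HahnSeries.algebraMap_apply',
    PowerSeries.algebraMap_apply', show (s : ℤ) + m - (s - i) = i + m by ring]
  rw [PowerSeries.coeff_coe]
  split_ifs with h1 h2 h2
  · omega
  · rfl
  · have : ((i : ℤ) + m).natAbs = ((i : ℤ) + m).toNat := by omega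
    simp [this]
  · omega

/-- The integer `σ_N`: the least `m` such that `x ^ (s + m)` occurs in `N · x ^ s` with a
coefficient that is not identically zero in `s`. For `N ≠ 0` such `m` exist and are at least minus
the order of `N`. -/
def PolyDiffOp.sigma {C : Type u} [Field C] (N : PolyDiffOp C) : ℤ :=
  sInf {m : ℤ | N.shiftCoeff m ≠ 0}

/-- The indicial polynomial of `N` at `0`: the polynomial `p₀` in
`N · x ^ s = x ^ (s + σ_N) (p₀(s) + p₁(s) x + ⋯ + pₜ(s) x ^ t)`, `p₀ ≠ 0`. -/
def PolyDiffOp.indicial {C : Type u} [Field C] (N : PolyDiffOp C) : C[X] :=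
  N.shiftCoeff N.sigma

/-- `Z_N`, the set of nonnegative integer roots of the indicial polynomial of `N` at `0`. -/
def PolyDiffOp.indicialRoots {C : Type u} [Field C] (N : PolyDiffOp C) : Set ℕ :=
  {k | N.indicial.eval (k : C) = 0}

/-! ### Colon spaces and truncations -/

/-- The colon space `(V : U) = {h ∈ C((x)) | h U ⊆ V}` in `C((x))`. -/
def colonSpace {C : Type u} [Field C] (V : Submodule C (LaurentSeries C))
    (U : Set (LaurentSeries C)) : Submodule C (LaurentSeries C) where
  carrier := {h | ∀ v ∈ U, h * v ∈ V}
  add_mem' := by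
    intro a b ha hb v hv
    rw [add_mul]
    exact V.add_mem (ha v hv) (hb v hv)
  zero_mem' := by
    intro v _
    rw [zero_mul]
    exact V.zero_mem
  smul_mem' := by
    intro c a ha v hv
    rw [← HahnSeries.C_mul_eq_smul, mul_assoc, HahnSeries.C_mul_eq_smul]
    exact V.smul_mem c (ha v hv)

/-- The subspace `C[[x]]` of `C((x))`: the series without negative powers of `x`. -/
def powerSeriesSubspace (C : Type u) [Field C] : Submodule C (LaurentSeries C) where
  carrier := {f | ∀ i < 0, f.coeff i = 0}
  add_mem' := by
    intro f g hf hg i hi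
    rw [HahnSeries.coeff_add, hf i hi, hg i hi, add_zero]
  zero_mem' := fun _ _ => rfl
  smul_mem' := by
    intro c f hf i hi
    rw [HahnSeries.coeff_smul, hf i hi, smul_zero]

/-- The truncation `T_k : ∑ aᵢ xⁱ ↦ ∑_{i ≤ k} aᵢ xⁱ` on `C((x))`. -/
def truncation (C : Type u) [Field C] (k : ℤ) : LaurentSeries C →ₗ[C] LaurentSeries C :=
  HahnSeries.truncLTLinearMap C (k + 1)

/-- `f = x ^ m + O(x ^ (m + 1))`. -/
def HasInitialTerm {C : Type u} [Field C] (f : LaurentSeries C) (m : ℤ) : Prop :=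
  f.coeff m = 1 ∧ ∀ i < m, f.coeff i = 0

end

/-! ### Existence of symmetric products -/

section SymProduct

variable {C : Type u} [Field C] {F : Type u} [CommRing F] [Algebra (RatFunc C) F]

/-! Let `G = g₁ ⋯ gᵣ`, a series of order `0 + 1 + ⋯ + (r - 1) = r(r-1)/2`. If `h ∈ Wᵢ`, then `h G`
is the product of `h gᵢ ∈ V(M)` with the other `r - 1` solutions of `L`, hence a solution of `N = M
⊗ L^{⊗(r-1)}`. The product `h G` is formed in the same way for every `i`. So for `h₁ ∈ Wᵢ` and `h₂ ∈
Wⱼ` the series `(h₁ - h₂) G` lies in `V(N)`; if it is nonzero, its order belongs to `Z_N`, which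
bounds the order of `h₁ - h₂` by `k₀`. For `k > k₀` equal truncations therefore force `h₁ = h₂`,
even across different `Wᵢ` (`eq_zero_of_truncation_eq_zero`). Thus `T_k` is injective on `⋂ Wᵢ` and
commutes with this intersection, which equals `(V(M) : V(L))` by `colonSpace_eq_iInf`.

The facts needed about `N` are that it is nonzero and kills the products in question, which rests on
the existence of symmetric products (`exists_isSymProduct`), and that orders of its solutions are
indicial roots (`PolyDiffOp.order_mem_indicialRoots`). The description of the `Wᵢ` is echelon-form
linear algebra for bases of orders `0, 1, …`. -/

theorem DiffOp.apply_eq_sum_range (δ : F → F) (L : DiffOp C) (f : F) {n : ℕ}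
    (hn : L.natDegree < n) :
    L.apply δ f = ∑ i ∈ Finset.range n, algebraMap (RatFunc C) F (L.coeff i) * δ^[i] f :=
  Polynomial.sum_over_range' L (by simp) n hn

theorem DiffOp.apply_C_mul (δ : F → F) (a : RatFunc C) (L : DiffOp C) (f : F) :
    DiffOp.apply δ (Polynomial.C a * L : DiffOp C) f =
      algebraMap (RatFunc C) F a * L.apply δ f := by
  rw [DiffOp.apply_eq_sum_range δ L f (Nat.lt_succ_self _), DiffOp.apply_eq_sum_range δ _ f
    (Nat.lt_succ_of_le (Polynomial.natDegree_C_mul_le a L)), Finset.mul_sum]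
  simp [mul_assoc]

theorem AnnihilatesProducts.C_mul {L₁ L₂ P : DiffOp C} (h : AnnihilatesProducts L₁ L₂ P)
    (a : RatFunc C) : AnnihilatesProducts L₁ L₂ (Polynomial.C a * P) := by
  intro F _ _ δ hδ f₁ f₂ h₁ h₂
  rw [DiffOp.apply_C_mul, h F δ hδ f₁ f₂ h₁ h₂, mul_zero]

theorem ExtendsDdx.map_sum {δ : F → F} (hδ : ExtendsDdx C δ) {ι : Type*} (s : Finset ι)
    (f : ι → F) : δ (∑ i ∈ s, f i) = ∑ i ∈ s, δ (f i) :=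
  _root_.map_sum (AddMonoidHom.mk' δ hδ.map_add) f s

theorem ExtendsDdx.map_polynomial {δ : F → F} (hδ : ExtendsDdx C δ) (p : C[X]) :
    δ (algebraMap (RatFunc C) F (algebraMap C[X] (RatFunc C) p)) =
      algebraMap (RatFunc C) F (algebraMap C[X] (RatFunc C) (derivative p)) := by
  induction p using Polynomial.induction_on' with
  | add p q hp hq => simp [hδ.map_add, hp, hq]
  | monomial n a =>
    induction n with
    | zero => simpa using hδ.map_C a
    | succ n ih =>
      rw [← Polynomial.monomial_mul_X, map_mul, map_mul, hδ.leibniz, ih, RatFunc.algebraMap_X,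
        hδ.map_X, derivative_mul, derivative_X]
      simp

/-- A derivation extending `d/dx` is determined on the image of `C(x)`. -/
theorem exists_ratFunc_derivative (a : RatFunc C) :
    ∃ a' : RatFunc C, ∀ (F : Type u) [CommRing F] [Algebra (RatFunc C) F] (δ : F → F),
      ExtendsDdx C δ → δ (algebraMap (RatFunc C) F a) = algebraMap (RatFunc C) F a' := by
  have hq : algebraMap C[X] (RatFunc C) a.denom ≠ 0 := RatFunc.algebraMap_ne_zero a.denom_ne_zero
  set p := algebraMap C[X] (RatFunc C) a.num with hp
  set q := algebraMap C[X] (RatFunc C) a.denom with hq'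
  have hpq : a * q = p := by
    rw [← eq_div_iff hq, hp, hq', RatFunc.num_div_denom]
  -- Differentiate `a q = p` and solve for `δ a`. The image of `q` is a unit in `F`, even if `F` has
  -- zero divisors.
  refine ⟨(algebraMap C[X] (RatFunc C) (derivative a.num) -
    a * algebraMap C[X] (RatFunc C) (derivative a.denom)) * q⁻¹, ?_⟩
  intro F _ _ δ hδ
  have h1 := hδ.leibniz (algebraMap (RatFunc C) F a) (algebraMap (RatFunc C) F q)
  rw [← map_mul, hpq, hp, hq', hδ.map_polynomial, hδ.map_polynomial, ← hq'] at h1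
  have h2 : algebraMap (RatFunc C) F q * algebraMap (RatFunc C) F q⁻¹ = 1 := by
    rw [← map_mul, mul_inv_cancel₀ hq, map_one]
  rw [map_mul, map_sub, map_mul, h1, add_sub_cancel_right, mul_assoc, h2, mul_one]

/-- The companion matrix of a nonzero operator: the derivatives of order at most the order of the
operator of each of its solutions are combinations of the derivatives of lower order. -/
theorem DiffOp.exists_companion {L : DiffOp C} (hL : L ≠ 0) :
    ∃ A : Fin L.natDegree → Fin L.natDegree → RatFunc C,
      ∀ (F : Type u) [CommRing F] [Algebra (RatFunc C) F] (δ : F → F) (f : F),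
        L.apply δ f = 0 → ∀ l : Fin L.natDegree,
          δ (δ^[l] f) = ∑ p, algebraMap (RatFunc C) F (A l p) * δ^[p] f := by
  have hlc : L.leadingCoeff ≠ 0 := Polynomial.leadingCoeff_ne_zero.mpr hL
  -- Every row but the last only shifts the derivative; the last one solves `L · f = 0` for the top
  -- derivative.
  refine ⟨fun l p => if (l : ℕ) + 1 < L.natDegree then (if (p : ℕ) = l + 1 then 1 else 0)
    else -(L.leadingCoeff⁻¹ * L.coeff p), ?_⟩
  intro F _ _ δ f hf l
  rw [← Function.iterate_succ_apply' δ]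
  beta_reduce
  split_ifs with h
  · rw [Finset.sum_eq_single (⟨l + 1, h⟩ : Fin L.natDegree)]
    · simp
    · intro p _ hp
      rw [if_neg (fun h' => hp (Fin.ext h')), map_zero, zero_mul]
    · simp
  · have hl : (l : ℕ) + 1 = L.natDegree := by omega
    rw [DiffOp.apply_eq_sum_range δ L f (Nat.lt_succ_self _), Finset.sum_range_succ] at hf
    have h2 : algebraMap (RatFunc C) F L.leadingCoeff⁻¹ *
        algebraMap (RatFunc C) F L.leadingCoeff = 1 := by
      rw [← map_mul, inv_mul_cancel₀ hlc, map_one]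
    have h3 := eq_neg_of_add_eq_zero_right hf
    simp only [map_neg, map_mul, neg_mul, Finset.sum_neg_distrib, mul_assoc]
    rw [← Finset.mul_sum, Fin.sum_univ_eq_sum_range
      (fun p => algebraMap (RatFunc C) F (L.coeff p) * δ^[p] f) L.natDegree, ← mul_neg, ← h3,
      Polynomial.coeff_natDegree, ← mul_assoc, h2, one_mul, Nat.succ_eq_add_one, hl]

/-- A solution is a combination of its derivatives of order less than that of the operator,
also if the operator has order zero. -/
theorem DiffOp.exists_eq_sum_iterate {L : DiffOp C} (hL : L ≠ 0) :
    ∃ v : Fin L.natDegree → RatFunc C,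
      ∀ (F : Type u) [CommRing F] [Algebra (RatFunc C) F] (δ : F → F) (f : F),
        L.apply δ f = 0 → f = ∑ p, algebraMap (RatFunc C) F (v p) * δ^[p] f := by
  refine ⟨fun p => if (p : ℕ) = 0 then 1 else 0, ?_⟩
  intro F _ _ δ f hf
  rw [Fin.sum_univ_eq_sum_range
    (fun p => algebraMap (RatFunc C) F (if p = 0 then 1 else 0) * δ^[p] f) L.natDegree]
  -- In order zero the sum is empty, and `f = 0` because the only coefficient of `L` is a unit.
  rcases Nat.eq_zero_or_pos L.natDegree with h | h
  · have hc : L.coeff 0 ≠ 0 := by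
      rw [← h]
      exact Polynomial.leadingCoeff_ne_zero.mpr hL
    rw [DiffOp.apply_eq_sum_range δ L f (Nat.lt_succ_self _), h] at hf
    have h2 : algebraMap (RatFunc C) F (L.coeff 0)⁻¹ * algebraMap (RatFunc C) F (L.coeff 0) = 1 := by
      rw [← map_mul, inv_mul_cancel₀ hc, map_one]
    simp only [Nat.succ_eq_add_one, zero_add, Finset.sum_range_one, Function.iterate_zero,
      id_eq] at hf
    rw [h, Finset.sum_range_zero, ← one_mul f, ← h2, mul_assoc, hf, mul_zero]
  · rw [Finset.sum_eq_single_of_mem 0 (Finset.mem_range.mpr h)]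
    · simp
    · intro p _ hp
      simp [hp]

/-- Every derivative of a product of solutions is a universal combination of products of
derivatives of low order. -/
theorem DiffOp.exists_iterate_mul {L₁ L₂ : DiffOp C} (h₁ : L₁ ≠ 0) (h₂ : L₂ ≠ 0) (k : ℕ) :
    ∃ v : Fin L₁.natDegree × Fin L₂.natDegree → RatFunc C,
      ∀ (F : Type u) [CommRing F] [Algebra (RatFunc C) F] (δ : F → F), ExtendsDdx C δ →
        ∀ f₁ f₂ : F, L₁.apply δ f₁ = 0 → L₂.apply δ f₂ = 0 →
          δ^[k] (f₁ * f₂) = ∑ p, algebraMap (RatFunc C) F (v p) * (δ^[p.1] f₁ * δ^[p.2] f₂) := by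
  induction k with
  | zero =>
    obtain ⟨v₁, hv₁⟩ := exists_eq_sum_iterate h₁
    obtain ⟨v₂, hv₂⟩ := exists_eq_sum_iterate h₂
    refine ⟨fun p => v₁ p.1 * v₂ p.2, ?_⟩
    intro F _ _ δ hδ f₁ f₂ hf₁ hf₂
    rw [Function.iterate_zero, id_eq]
    conv_lhs => rw [hv₁ F δ f₁ hf₁, hv₂ F δ f₂ hf₂]
    rw [Finset.sum_mul_sum, Fintype.sum_prod_type]
    simp only [map_mul]
    refine Finset.sum_congr rfl fun i _ => Finset.sum_congr rfl fun j _ => ?_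
    ring
  | succ k ih =>
    obtain ⟨v, hv⟩ := ih
    obtain ⟨A, hA⟩ := exists_companion h₁
    obtain ⟨B, hB⟩ := exists_companion h₂
    choose v' hv' using fun p => exists_ratFunc_derivative (v p)
    -- The product rule: differentiate the coefficient, then each factor through its companion
    -- matrix.
    refine ⟨fun p => v' p + (∑ l, v (l, p.2) * A l p.1 + ∑ m, v (p.1, m) * B m p.2), ?_⟩
    intro F _ _ δ hδ f₁ f₂ hf₁ hf₂
    rw [Function.iterate_succ_apply', hv F δ hδ f₁ f₂ hf₁ hf₂, hδ.map_sum]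
    simp only [hδ.leibniz, hv' _ F δ hδ, hA F δ f₁ hf₁, hB F δ f₂ hf₂, map_add, add_mul, mul_add,
      Finset.sum_add_distrib]
    congr 1
    congr 1
    · rw [Fintype.sum_prod_type_right, Fintype.sum_prod_type_right]
      refine Finset.sum_congr rfl fun q _ => ?_
      simp only [map_sum, map_mul, Finset.sum_mul, Finset.mul_sum]
      rw [Finset.sum_comm]
      refine Finset.sum_congr rfl fun i _ => Finset.sum_congr rfl fun j _ => ?_
      ring
    · rw [Fintype.sum_prod_type, Fintype.sum_prod_type]
      refine Finset.sum_congr rfl fun q _ => ?_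
      simp only [map_sum, map_mul, Finset.sum_mul, Finset.mul_sum]
      rw [Finset.sum_comm]
      refine Finset.sum_congr rfl fun i _ => Finset.sum_congr rfl fun j _ => ?_
      ring

/-- A dimension count: the coefficient vectors of the first `d + 1` derivatives of `f₁ f₂` lie in a
space of dimension `d`, the product of the orders. Since these vectors depend neither on the
extension nor on the solutions, one linear relation among them gives an operator valid everywhere.
-/
theorem exists_annihilatesProducts {L₁ L₂ : DiffOp C} (h₁ : L₁ ≠ 0) (h₂ : L₂ ≠ 0) :
    ∃ P : DiffOp C, P ≠ 0 ∧ AnnihilatesProducts L₁ L₂ P := by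
  choose v hv using DiffOp.exists_iterate_mul h₁ h₂
  set d := Fintype.card (Fin L₁.natDegree × Fin L₂.natDegree) with hd
  have hdep : ¬ LinearIndependent (RatFunc C) fun k : Fin (d + 1) => v k := by
    intro h
    have := h.fintype_card_le_finrank
    rw [Module.finrank_fintype_fun_eq_card, Fintype.card_fin] at this
    omega
  obtain ⟨c, hc, k₀, hk₀⟩ := Fintype.not_linearIndependent_iff.mp hdep
  set P : DiffOp C := ∑ k : Fin (d + 1), Polynomial.monomial (k : ℕ) (c k) with hP
  have hcoeff : ∀ k : Fin (d + 1), P.coeff k = c k := by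
    intro k
    rw [hP, Polynomial.finsetSum_coeff, Finset.sum_eq_single k]
    · simp
    · intro b _ hb
      rw [Polynomial.coeff_monomial, if_neg (fun h => hb (Fin.ext h))]
    · simp
  have hdeg : P.natDegree < d + 1 := by
    refine Nat.lt_succ_of_le (Polynomial.natDegree_sum_le_of_forall_le _ _ fun k _ => ?_)
    exact (Polynomial.natDegree_monomial_le _).trans (Nat.le_of_lt_succ k.2)
  refine ⟨P, fun h => hk₀ ?_, ?_⟩
  · rw [← hcoeff, h, Polynomial.coeff_zero]
  · intro F _ _ δ hδ f₁ f₂ hf₁ hf₂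
    rw [DiffOp.apply_eq_sum_range δ P _ hdeg, ← Fin.sum_univ_eq_sum_range
      (fun i => algebraMap (RatFunc C) F (P.coeff i) * δ^[i] (f₁ * f₂))]
    simp only [hcoeff, hv _ F δ hδ f₁ f₂ hf₁ hf₂, Finset.mul_sum]
    rw [Finset.sum_comm]
    refine Finset.sum_eq_zero fun p _ => ?_
    have hp : ∑ k, c k * v k p = 0 := by simpa using congrFun hc p
    simp only [← mul_assoc, ← map_mul, ← Finset.sum_mul, ← _root_.map_sum, hp, map_zero, zero_mul]

/-- Clearing denominators, dividing by the content and rescaling by a constant all amount to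
multiplication by an element of `C(x)`, which changes neither the order nor the property of
annihilating products. -/
theorem exists_primitive_monic_leadingCoeff {P : DiffOp C} (hP : P ≠ 0) :
    ∃ (Q : PolyDiffOp C) (a : RatFunc C), Q.IsPrimitive ∧ Q.leadingCoeff.Monic ∧
      Q.natDegree = P.natDegree ∧ Q.toDiffOp = Polynomial.C a * P := by
  classical
  let _ : NormalizedGCDMonoid C[X] := Classical.choice inferInstance
  obtain ⟨b, hb, hbP⟩ := IsLocalization.integerNormalization_spec (nonZeroDivisors C[X]) P
  set Q₀ := IsLocalization.integerNormalization (nonZeroDivisors C[X]) P with hQ₀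
  have hQ₀0 : Q₀ ≠ 0 := fun h => hP (IsFractionRing.integerNormalization_eq_zero_iff.mp h)
  have hprim := Q₀.isPrimitive_primPart
  set Q₁ := Q₀.primPart with hQ₁
  have hQ₁0 : Q₁ ≠ 0 := hprim.ne_zero
  have hlc : Q₁.leadingCoeff.leadingCoeff ≠ 0 := by simpa using hQ₁0
  have hc : algebraMap C[X] (RatFunc C) Q₀.content ≠ 0 :=
    RatFunc.algebraMap_ne_zero (fun h => hQ₀0 (Polynomial.content_eq_zero_iff.mp h))
  set u : C[X] := Polynomial.C (Q₁.leadingCoeff.leadingCoeff)⁻¹ with hu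
  have huu : IsUnit u := Polynomial.isUnit_C.mpr (IsUnit.mk0 _ (inv_ne_zero hlc))
  have hmap : (Polynomial.C u * Q₁).map (algebraMap C[X] (RatFunc C)) =
      Polynomial.C (algebraMap C[X] (RatFunc C) u * (algebraMap C[X] (RatFunc C) Q₀.content)⁻¹ *
        algebraMap C[X] (RatFunc C) b) * P := by
    have h1 : Q₀.map (algebraMap C[X] (RatFunc C)) =
        Polynomial.C (algebraMap C[X] (RatFunc C) Q₀.content) *
          Q₁.map (algebraMap C[X] (RatFunc C)) := by
      conv_lhs => rw [Q₀.eq_C_content_mul_primPart]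
      rw [Polynomial.map_mul, Polynomial.map_C]
    have h2 : b • P = Polynomial.C (algebraMap C[X] (RatFunc C) b) * P := by
      rw [← Polynomial.smul_eq_C_mul, algebraMap_smul]
    rw [Polynomial.C_mul, mul_assoc, ← h2, ← hbP, h1, Polynomial.map_mul, Polynomial.map_C,
      Polynomial.C_mul, mul_assoc, ← mul_assoc (Polynomial.C _⁻¹), ← Polynomial.C_mul,
      inv_mul_cancel₀ hc, Polynomial.C_1, one_mul]
  refine ⟨Polynomial.C u * Q₁, _, ?_, ?_, ?_, hmap⟩
  · intro a ha
    refine hprim a ?_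
    exact (Polynomial.isUnit_C.mpr huu).dvd_mul_left.mp ha
  · rw [Polynomial.leadingCoeff_mul, Polynomial.leadingCoeff_C, Polynomial.Monic,
      Polynomial.leadingCoeff_mul, hu, Polynomial.leadingCoeff_C, inv_mul_cancel₀ hlc]
  · have hne : Polynomial.C u * Q₁ ≠ 0 :=
      mul_ne_zero (Polynomial.C_ne_zero.mpr huu.ne_zero) hQ₁0
    have hinj := RatFunc.algebraMap_injective C
    rw [← Polynomial.natDegree_map_eq_of_injective hinj, hmap]
    refine Polynomial.natDegree_C_mul (fun h => hne ?_)
    rw [h, Polynomial.C_0, zero_mul] at hmap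
    exact (Polynomial.map_eq_zero_iff hinj).mp hmap

theorem exists_isSymProduct {L₁ L₂ : DiffOp C} (h₁ : L₁ ≠ 0) (h₂ : L₂ ≠ 0) :
    ∃ P, IsSymProduct L₁ L₂ P := by
  classical
  have hex : ∃ n, ∃ P : DiffOp C, P.natDegree = n ∧ P ≠ 0 ∧ AnnihilatesProducts L₁ L₂ P := by
    obtain ⟨P, hP, hP'⟩ := exists_annihilatesProducts h₁ h₂
    exact ⟨_, P, rfl, hP, hP'⟩
  obtain ⟨P, hPn, hP, hP'⟩ := Nat.find_spec hex
  obtain ⟨Q, a, hQ₁, hQ₂, hQ₃, hQ₄⟩ := exists_primitive_monic_leadingCoeff hP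
  refine ⟨Q, hQ₁, hQ₂, ?_, ?_⟩
  · rw [hQ₄]
    exact hP'.C_mul a
  · intro P' h h'
    rw [hQ₃, hPn]
    exact Nat.find_min' hex ⟨P', rfl, h, h'⟩

/-- Excludes the default value `0` in the definition of `symProduct`. -/
theorem isSymProduct_symProduct {L₁ L₂ : DiffOp C} (h₁ : L₁ ≠ 0) (h₂ : L₂ ≠ 0) :
    IsSymProduct L₁ L₂ (symProduct L₁ L₂) := by
  have h := exists_isSymProduct h₁ h₂
  rw [symProduct, dif_pos h]
  exact h.choose_spec

theorem symProduct_ne_zero {L₁ L₂ : DiffOp C} (h₁ : L₁ ≠ 0) (h₂ : L₂ ≠ 0) :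
    symProduct L₁ L₂ ≠ 0 :=
  (isSymProduct_symProduct h₁ h₂).isPrimitive.ne_zero

theorem PolyDiffOp.toDiffOp_ne_zero {N : PolyDiffOp C} (hN : N ≠ 0) : N.toDiffOp ≠ 0 := fun h =>
  hN ((Polynomial.map_eq_zero_iff (RatFunc.algebraMap_injective C)).mp h)

theorem symPower_ne_zero {L : DiffOp C} (hL : L ≠ 0) : ∀ s, symPower L s ≠ 0
  | 0 => Polynomial.X_ne_zero
  | 1 => hL
  | s + 2 => PolyDiffOp.toDiffOp_ne_zero (symProduct_ne_zero (symPower_ne_zero hL (s + 1)) hL)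

theorem mul_mem_solutionSpace_symProduct {L₁ L₂ : DiffOp C} (h₁ : L₁ ≠ 0) (h₂ : L₂ ≠ 0)
    {f₁ f₂ : LaurentSeries C} (hf₁ : f₁ ∈ solutionSpace L₁) (hf₂ : f₂ ∈ solutionSpace L₂) :
    f₁ * f₂ ∈ solutionSpace (symProduct L₁ L₂).toDiffOp :=
  (isSymProduct_symProduct h₁ h₂).annihilates _ (ddx C) (ddx_extendsDdx C) f₁ f₂ hf₁ hf₂

theorem prod_mem_solutionSpace_symPower {L : DiffOp C} (hL : L ≠ 0) {ι : Type*} (s : Finset ι)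
    (y : ι → LaurentSeries C) (hy : ∀ i ∈ s, y i ∈ solutionSpace L) :
    ∏ i ∈ s, y i ∈ solutionSpace (symPower L s.card) := by
  classical
  induction s using Finset.induction_on with
  | empty =>
    have h : ddx C 1 = 0 := by simpa using (ddx_extendsDdx C).map_C 1
    change DiffOp.apply (ddx C) (Polynomial.X : DiffOp C) _ = 0
    rw [DiffOp.apply, Polynomial.sum_X_index (by simp)]
    simp [h]
  | insert a s ha ih =>
    rw [Finset.prod_insert ha, Finset.card_insert_of_notMem ha, mul_comm]
    have hs := ih fun i hi => hy i (Finset.mem_insert_of_mem hi)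
    have ha' := hy a (Finset.mem_insert_self a s)
    -- `symPower L 1` is `L` itself rather than a symmetric product with `D`, so a single factor is
    -- treated apart.
    cases hc : s.card with
    | zero =>
      rw [Finset.card_eq_zero.mp hc, Finset.prod_empty, one_mul]
      exact ha'
    | succ c =>
      rw [hc] at hs
      exact mul_mem_solutionSpace_symProduct (symPower_ne_zero hL (c + 1)) hL hs ha'

end SymProduct

/-! ### Orders of solutions and indicial roots -/

section Indicial

variable {C : Type u} [Field C]

theorem ddx_iterate_coeff (h : LaurentSeries C) (i : ℕ) (n : ℤ) :
    ((ddx C)^[i] h).coeff n =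
      (descPochhammer C i).eval ((n + i : ℤ) : C) * h.coeff (n + i) := by
  induction i generalizing n with
  | zero => simp
  | succ i ih =>
    rw [Function.iterate_succ_apply', ddx_coeff, ih, descPochhammer_succ_eval,
      show n + 1 + (i : ℤ) = n + ((i + 1 : ℕ) : ℤ) by push_cast; ring]
    push_cast
    ring

theorem algebraMap_polynomial_mul_coeff (p : C[X]) (h : LaurentSeries C) (m : ℤ) :
    (algebraMap (RatFunc C) (LaurentSeries C) (algebraMap C[X] (RatFunc C) p) * h).coeff m =
      p.sum fun j a => a * h.coeff (m - j) := by
  have hm : ∀ (j : ℕ) (a : C),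
      algebraMap (RatFunc C) (LaurentSeries C) (algebraMap C[X] (RatFunc C) (monomial j a)) =
        HahnSeries.single (j : ℤ) a := by
    intro j a
    rw [← IsScalarTower.algebraMap_apply, HahnSeries.algebraMap_apply',
      PowerSeries.algebraMap_apply', ← Polynomial.C_mul_X_pow_eq_monomial]
    simp [HahnSeries.ofPowerSeries_X_pow]
  conv_lhs => rw [p.as_sum_support]
  rw [map_sum, map_sum, Finset.sum_mul, HahnSeries.coeff_sum, Polynomial.sum_def]
  refine Finset.sum_congr rfl fun j _ => ?_
  rw [hm, HahnSeries.coeff_single_mul]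

theorem PolyDiffOp.apply_coeff (N : PolyDiffOp C) (h : LaurentSeries C) (m : ℤ) :
    (N.toDiffOp.apply (ddx C) h).coeff m = N.sum fun i a => a.sum fun j c =>
      c * ((descPochhammer C i).eval ((m - j + i : ℤ) : C) * h.coeff (m - j + i)) := by
  unfold DiffOp.apply PolyDiffOp.toDiffOp
  rw [Polynomial.sum_def, Polynomial.sum_def, Polynomial.support_map_of_injective _
    (RatFunc.algebraMap_injective C), HahnSeries.coeff_sum]
  refine Finset.sum_congr rfl fun i _ => ?_
  rw [Polynomial.coeff_map, algebraMap_polynomial_mul_coeff]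
  simp only [ddx_iterate_coeff]

/-- The falling factorials have distinct degrees and are thus linearly independent, so no
cancellation can occur between the terms `xʲ Dⁱ` on the diagonal `j - i = m`. -/
theorem coeff_eq_zero_of_shiftCoeff_eq_zero {N : PolyDiffOp C} {m : ℤ} (h : N.shiftCoeff m = 0)
    {i j : ℕ} (hij : (j : ℤ) = i + m) : (N.coeff i).coeff j = 0 := by
  let S : Polynomial.Sequence C := ⟨descPochhammer C, fun i => by
    rw [Polynomial.degree_eq_natDegree (monic_descPochhammer C i).ne_zero,
      descPochhammer_natDegree]⟩
  by_cases hi : i ∈ N.support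
  · have h0 := (linearIndependent_iff'.mp S.linearIndependent) N.support
      (fun i => if 0 ≤ (i : ℤ) + m then (N.coeff i).coeff ((i : ℤ) + m).toNat else 0)
      (by simpa only [PolyDiffOp.shiftCoeff, Polynomial.sum_def, ← Polynomial.smul_eq_C_mul]
        using h) i hi
    rw [if_pos (by omega), ← hij] at h0
    simpa using h0
  · simp [Polynomial.notMem_support_iff.mp hi]

/-- An infimum in `ℤ` is meaningful only for a nonempty set that is bounded below. The top term of
the leading coefficient provides a member, and minus the order is a lower bound. -/
theorem PolyDiffOp.isLeast_sigma {N : PolyDiffOp C} (hN : N ≠ 0) :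
    IsLeast {m : ℤ | N.shiftCoeff m ≠ 0} N.sigma := by
  have hne : {m : ℤ | N.shiftCoeff m ≠ 0}.Nonempty := by
    refine ⟨(N.leadingCoeff.natDegree : ℤ) - N.natDegree, fun h => ?_⟩
    have := coeff_eq_zero_of_shiftCoeff_eq_zero h (i := N.natDegree)
      (j := N.leadingCoeff.natDegree) (by ring)
    simp [hN] at this
  have hbdd : BddBelow {m : ℤ | N.shiftCoeff m ≠ 0} := by
    refine ⟨-(N.natDegree : ℤ), fun m hm => ?_⟩
    by_contra hlt
    refine hm (Finset.sum_eq_zero fun i hi => ?_)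
    have := Polynomial.le_natDegree_of_mem_supp i hi
    beta_reduce
    rw [if_neg (by omega), Polynomial.C_0, zero_mul]
  exact ⟨Int.csInf_mem hne hbdd, fun m hm => csInf_le hbdd hm⟩

theorem PolyDiffOp.indicial_ne_zero {N : PolyDiffOp C} (hN : N ≠ 0) : N.indicial ≠ 0 :=
  (isLeast_sigma hN).1

/-- Only the terms `xʲ Dⁱ` with `j - i = σ` contribute: for `j - i < σ` their coefficient vanishes
by minimality of `σ`, and for `j - i > σ` they meet a coefficient of `h` below `x ^ v`. -/
theorem PolyDiffOp.apply_coeff_add_sigma {N : PolyDiffOp C} (hN : N ≠ 0) {h : LaurentSeries C}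
    {v : ℤ} (hv : ∀ s < v, h.coeff s = 0) :
    (N.toDiffOp.apply (ddx C) h).coeff (v + N.sigma) = N.indicial.eval (v : C) * h.coeff v := by
  rw [apply_coeff, indicial, shiftCoeff, Polynomial.sum_def, Polynomial.sum_def,
    Polynomial.eval_finsetSum, Finset.sum_mul]
  refine Finset.sum_congr rfl fun i _ => ?_
  rw [Polynomial.eval_mul, Polynomial.eval_C, Polynomial.sum_def]
  have hterm : ∀ j ∈ (N.coeff i).support, (j : ℤ) ≠ i + N.sigma →
      (N.coeff i).coeff j * ((descPochhammer C i).eval ((v + N.sigma - j + i : ℤ) : C) *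
        h.coeff (v + N.sigma - j + i)) = 0 := by
    intro j _ hj
    rcases lt_or_gt_of_ne hj with hlt | hgt
    · have h0 : N.shiftCoeff ((j : ℤ) - i) = 0 := by
        by_contra hne
        have := (isLeast_sigma hN).2 hne
        omega
      rw [coeff_eq_zero_of_shiftCoeff_eq_zero h0 (i := i) (j := j) (by ring), zero_mul]
    · rw [hv _ (by omega), mul_zero, mul_zero]
  split_ifs with h0
  · obtain ⟨j, hj⟩ := Int.eq_ofNat_of_zero_le h0
    rw [hj, Int.toNat_natCast, Finset.sum_eq_single j]
    · rw [show v + N.sigma - (j : ℤ) + i = v by omega, mul_assoc]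
    · intro b hb hbj
      exact hterm b hb (by omega)
    · intro hj'
      rw [Polynomial.notMem_support_iff.mp hj', zero_mul]
  · rw [zero_mul, zero_mul]
    exact Finset.sum_eq_zero fun j hj => hterm j hj (by omega)

/-- The order of a solution is an indicial root. -/
theorem PolyDiffOp.order_mem_indicialRoots {N : PolyDiffOp C} (hN : N ≠ 0) {h : LaurentSeries C}
    (h0 : h ≠ 0) (hmem : h ∈ solutionSpace N.toDiffOp) {v : ℕ} (hv : h.order = v) :
    v ∈ N.indicialRoots := by
  have h1 := apply_coeff_add_sigma hN (h := h) (v := v)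
    fun s hs => HahnSeries.coeff_eq_zero_of_lt_order (by rwa [hv])
  rw [show N.toDiffOp.apply (ddx C) h = 0 from hmem, HahnSeries.coeff_zero, ← hv] at h1
  rcases mul_eq_zero.mp h1.symm with h2 | h2
  · rw [hv] at h2
    simpa [indicialRoots] using h2
  · exact absurd (HahnSeries.coeff_order_eq_zero.mp h2) h0

theorem PolyDiffOp.finite_indicialRoots [CharZero C] {N : PolyDiffOp C} (hN : N ≠ 0) :
    N.indicialRoots.Finite :=
  (Polynomial.finite_setOfPred_isRoot (indicial_ne_zero hN)).preimage Nat.cast_injective.injOn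

end Indicial

/-! ### Series with prescribed initial terms -/

section Truncation

variable {C : Type u} [Field C]

theorem truncation_coeff (k : ℤ) (h : LaurentSeries C) (i : ℤ) :
    (truncation C k h).coeff i = if i < k + 1 then h.coeff i else 0 := rfl

theorem truncation_eq_zero_iff {k : ℤ} {h : LaurentSeries C} :
    truncation C k h = 0 ↔ ∀ i < k + 1, h.coeff i = 0 := by
  constructor
  · intro h0 i hi
    have := congrArg (fun f => HahnSeries.coeff f i) h0
    simpa [truncation_coeff, hi] using this
  · intro h0
    ext i
    rw [truncation_coeff, HahnSeries.coeff_zero]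
    split_ifs with hi
    exacts [h0 i hi, rfl]

theorem le_order_of_coeff_eq_zero {h : LaurentSeries C} (h0 : h ≠ 0) {a : ℤ}
    (ha : ∀ i < a, h.coeff i = 0) : a ≤ h.order := by
  by_contra hlt
  exact h0 (HahnSeries.coeff_order_eq_zero.mp (ha _ (not_le.mp hlt)))

/-- The bound is assumed only for `h ≠ 0`, since the zero series has order `0` by convention. -/
theorem coeff_eq_zero_of_le_order {h : LaurentSeries C} {a i : ℤ} (ha : h ≠ 0 → a ≤ h.order)
    (hi : i < a) : h.coeff i = 0 := by
  by_cases h0 : h = 0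
  · rw [h0, HahnSeries.coeff_zero]
  · exact HahnSeries.coeff_eq_zero_of_lt_order (hi.trans_le (ha h0))

theorem mul_coeff_eq_zero_of_lt {f g : LaurentSeries C} {a b : ℤ} (hf : ∀ i < a, f.coeff i = 0)
    (hg : ∀ i < b, g.coeff i = 0) {i : ℤ} (hi : i < a + b) : (f * g).coeff i = 0 := by
  refine coeff_eq_zero_of_le_order (fun h0 => ?_) hi
  rw [HahnSeries.order_mul (left_ne_zero_of_mul h0) (right_ne_zero_of_mul h0)]
  exact add_le_add (le_order_of_coeff_eq_zero (left_ne_zero_of_mul h0) hf)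
    (le_order_of_coeff_eq_zero (right_ne_zero_of_mul h0) hg)

theorem HasInitialTerm.ne_zero {f : LaurentSeries C} {m : ℤ} (hf : HasInitialTerm f m) : f ≠ 0 := by
  rintro rfl
  exact zero_ne_one hf.1

theorem HasInitialTerm.order_eq {f : LaurentSeries C} {m : ℤ} (hf : HasInitialTerm f m) :
    f.order = m :=
  le_antisymm (HahnSeries.order_le_of_coeff_ne_zero (by rw [hf.1]; exact one_ne_zero))
    (le_order_of_coeff_eq_zero hf.ne_zero hf.2)

theorem HasInitialTerm.truncation {f : LaurentSeries C} {m k : ℤ} (hf : HasInitialTerm f m)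
    (hk : m ≤ k) : HasInitialTerm (truncation C k f) m := by
  refine ⟨?_, fun i hi => ?_⟩
  · rw [truncation_coeff, if_pos (by omega), hf.1]
  · rw [truncation_coeff, if_pos (by omega), hf.2 i hi]

theorem order_prod {ι : Type*} (s : Finset ι) (g : ι → LaurentSeries C) (hg : ∀ i ∈ s, g i ≠ 0) :
    (∏ i ∈ s, g i).order = ∑ i ∈ s, (g i).order := by
  classical
  induction s using Finset.induction_on with
  | empty => simp
  | insert a s ha ih =>
    rw [Finset.prod_insert ha, Finset.sum_insert ha,
      HahnSeries.order_mul (hg a (Finset.mem_insert_self a s)) (Finset.prod_ne_zero_iff.mpr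
        fun i hi => hg i (Finset.mem_insert_of_mem hi)),
      ih fun i hi => hg i (Finset.mem_insert_of_mem hi)]

/-- The coefficients of a quotient up to `x ^ k` only depend on those of the numerator and the
denominator up to `x ^ (k + i)`, where `i` is the order of the denominator and that of the numerator
is not smaller. -/
theorem truncation_div_truncation {f g : LaurentSeries C} {i k l : ℤ} (hf : ∀ s < i, f.coeff s = 0)
    (hg : HasInitialTerm g i) (hk : 0 ≤ k) (hl : k + i ≤ l) :
    truncation C k (truncation C l f / truncation C l g) = truncation C k (f / g) := by
  have hg' : HasInitialTerm (truncation C l g) i := hg.truncation (by omega)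
  set f' := truncation C l f with hf'
  set g' := truncation C l g with hgt
  rw [← sub_eq_zero, ← map_sub, truncation_eq_zero_iff]
  intro s hs
  refine coeff_eq_zero_of_le_order (fun h0 => ?_) hs
  -- After clearing denominators both errors on the right start at `x ^ (l + 1)` and are multiplied
  -- by series of order at least `i`. Removing the order `2 i` of `g' g` leaves at least `l + 1 - i
  -- ≥ k + 1`.
  have hE : (f' / g' - f / g) * (g' * g) = (f' - f) * g + f * (g - g') := by
    field_simp [hg.ne_zero, hg'.ne_zero]
    ring
  have hne : g' * g ≠ 0 := mul_ne_zero hg'.ne_zero hg.ne_zero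
  have hcut : ∀ (h : LaurentSeries C), ∀ t < l + 1, (truncation C l h - h).coeff t = 0 := by
    intro h t ht
    rw [HahnSeries.coeff_sub, truncation_coeff, if_pos ht, sub_self]
  have h1 : l + 1 + i ≤ ((f' / g' - f / g) * (g' * g)).order := by
    refine le_order_of_coeff_eq_zero (mul_ne_zero h0 hne) fun t ht => ?_
    rw [hE, HahnSeries.coeff_add, mul_coeff_eq_zero_of_lt (hcut f) hg.2 ht,
      mul_coeff_eq_zero_of_lt (b := l + 1) hf (fun t ht => ?_) (by omega), add_zero]
    rw [← neg_sub, HahnSeries.coeff_neg, hcut g t ht, neg_zero]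
  rw [HahnSeries.order_mul h0 hne, HahnSeries.order_mul hg'.ne_zero hg.ne_zero, hg.order_eq,
    hg'.order_eq] at h1
  omega

end Truncation

/-! ### Colon spaces -/

section Colon

variable {C : Type u} [Field C]

theorem mem_colonSpace_singleton {V : Submodule C (LaurentSeries C)} {g h : LaurentSeries C} :
    h ∈ colonSpace V {g} ↔ h * g ∈ V := by
  change (∀ v ∈ ({g} : Set (LaurentSeries C)), h * v ∈ V) ↔ _
  simp

theorem Module.Basis.coe_eq_sum_repr {n : ℕ} {V : Submodule C (LaurentSeries C)}
    (f : Module.Basis (Fin n) C V) (v : V) :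
    (v : LaurentSeries C) = ∑ j, f.repr v j • (f j : LaurentSeries C) := by
  conv_lhs => rw [← f.sum_repr v, Submodule.coe_sum]
  rfl

/-- In the expansion of a series of order at least `i` in a basis of series of orders `0, 1, …`
only the basis elements from the `i`-th on occur. -/
theorem repr_eq_zero_of_coeff_eq_zero {n : ℕ} {V : Submodule C (LaurentSeries C)}
    (f : Module.Basis (Fin n) C V)
    (hf : ∀ j, HasInitialTerm (f j : LaurentSeries C) (j : ℕ)) (v : V) {i : ℕ}
    (hv : ∀ s < (i : ℤ), (v : LaurentSeries C).coeff s = 0) (j : Fin n) (hj : (j : ℕ) < i) :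
    f.repr v j = 0 := by
  obtain ⟨j, hjn⟩ := j
  induction j using Nat.strong_induction_on with
  | _ j ih =>
    -- At `x ^ j` the earlier basis elements drop out by induction and the later ones by their
    -- order, so only the coordinate `j` remains.
    have h1 := congrArg (fun h => HahnSeries.coeff h (j : ℤ)) (f.coe_eq_sum_repr v)
    simp only [HahnSeries.coeff_sum, HahnSeries.coeff_smul] at h1
    rw [hv j (by simpa using hj), Finset.sum_eq_single (⟨j, hjn⟩ : Fin n), (hf ⟨j, hjn⟩).1,
      smul_eq_mul, mul_one] at h1
    · exact h1.symm
    · rintro ⟨b, hb⟩ _ hbj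
      have hbj' : b ≠ j := fun h => hbj (Fin.ext h)
      rcases lt_or_gt_of_ne hbj' with hlt | hgt
      · rw [ih b hlt hb (hlt.trans hj), zero_smul]
      · rw [(hf ⟨b, hb⟩).2 j (by simpa using hgt), smul_zero]
    · simp

/-- For `h ∈ C[[x]]` the series `h g` has order at least `i` or is zero, so its expansion only
involves the `fⱼ` with `j ≥ i`; for these, in turn, `fⱼ / g` has order `j - i ≥ 0`. -/
theorem colonSpace_singleton_inf_powerSeriesSubspace {n : ℕ} {V : Submodule C (LaurentSeries C)}
    (f : Module.Basis (Fin n) C V)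
    (hf : ∀ j, HasInitialTerm (f j : LaurentSeries C) (j : ℕ)) {g : LaurentSeries C} {i : ℕ}
    (hg : HasInitialTerm g i) :
    colonSpace V {g} ⊓ powerSeriesSubspace C = Submodule.span C
      {h | ∃ j : Fin n, i ≤ (j : ℕ) ∧ h = (f j : LaurentSeries C) / g} := by
  have hg0 := hg.ne_zero
  apply le_antisymm
  · rintro h ⟨h1, h2⟩
    rw [SetLike.mem_coe, mem_colonSpace_singleton] at h1
    have hv : ∀ s < (i : ℤ), (h * g).coeff s = 0 := fun s hs =>
      mul_coeff_eq_zero_of_lt (a := 0) h2 hg.2 (by omega)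
    have hr := repr_eq_zero_of_coeff_eq_zero f hf ⟨h * g, h1⟩ hv
    have hsum : h = ∑ j, f.repr ⟨h * g, h1⟩ j • ((f j : LaurentSeries C) / g) := by
      rw [eq_comm, ← mul_left_inj' hg0, Finset.sum_mul]
      refine Eq.trans ?_ (f.coe_eq_sum_repr ⟨h * g, h1⟩).symm
      refine Finset.sum_congr rfl fun j _ => ?_
      rw [← HahnSeries.C_mul_eq_smul, mul_assoc, div_mul_cancel₀ _ hg0, HahnSeries.C_mul_eq_smul]
    rw [hsum]
    refine Submodule.sum_mem _ fun j _ => ?_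
    by_cases hj : (j : ℕ) < i
    · rw [hr j hj, zero_smul]
      exact Submodule.zero_mem _
    · exact Submodule.smul_mem _ _ (Submodule.subset_span ⟨j, not_lt.mp hj, rfl⟩)
  · rw [Submodule.span_le]
    rintro _ ⟨j, hij, rfl⟩
    refine ⟨?_, fun s hs => coeff_eq_zero_of_le_order (a := 0) (fun h0 => ?_) hs⟩
    · rw [SetLike.mem_coe, mem_colonSpace_singleton, div_mul_cancel₀ _ hg0]
      exact (f j).2
    · have h1 := HahnSeries.order_mul h0 hg0
      rw [div_mul_cancel₀ _ hg0, (hf j).order_eq, hg.order_eq] at h1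
      omega

/-- Intersecting with `C[[x]]` loses nothing: the first basis element of `U` has order `0`, so `h`
has the same order as its product with it, which lies in `V ⊆ C[[x]]`. -/
theorem colonSpace_eq_iInf {n r : ℕ} (hr : 0 < r) {V U : Submodule C (LaurentSeries C)}
    (f : Module.Basis (Fin n) C V)
    (hf : ∀ j, HasInitialTerm (f j : LaurentSeries C) (j : ℕ)) (g : Module.Basis (Fin r) C U)
    (hg : ∀ i, HasInitialTerm (g i : LaurentSeries C) (i : ℕ)) :
    colonSpace V (U : Set (LaurentSeries C)) =
      ⨅ i, colonSpace V {(g i : LaurentSeries C)} ⊓ powerSeriesSubspace C := by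
  ext h
  simp only [Submodule.mem_iInf, Submodule.mem_inf, mem_colonSpace_singleton]
  constructor
  · intro hh
    have hmem : ∀ i, h * (g i : LaurentSeries C) ∈ V := fun i => hh _ (g i).2
    refine fun i => ⟨hmem i, fun s hs => coeff_eq_zero_of_le_order (a := 0) (fun h0 => ?_) hs⟩
    have h1 := HahnSeries.order_mul h0 (hg ⟨0, hr⟩).ne_zero
    have h2 : 0 ≤ (h * (g ⟨0, hr⟩ : LaurentSeries C)).order := by
      refine le_order_of_coeff_eq_zero (mul_ne_zero h0 (hg ⟨0, hr⟩).ne_zero) fun s hs => ?_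
      have h3 := f.coe_eq_sum_repr ⟨_, hmem ⟨0, hr⟩⟩
      simp only at h3
      rw [h3, HahnSeries.coeff_sum]
      refine Finset.sum_eq_zero fun j _ => ?_
      rw [HahnSeries.coeff_smul, (hf j).2 s (by omega), smul_zero]
    rw [h1, (hg ⟨0, hr⟩).order_eq] at h2
    simpa using h2
  · intro hh v hv
    have h3 := g.coe_eq_sum_repr ⟨v, hv⟩
    simp only at h3
    rw [h3, Finset.mul_sum]
    refine Submodule.sum_mem _ fun i _ => ?_
    rw [← HahnSeries.C_mul_eq_smul, mul_left_comm, HahnSeries.C_mul_eq_smul]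
    exact V.smul_mem _ (hh i).1

end Colon

/-! ### Solutions of symmetric products and truncations -/

section SolutionProducts

variable {C : Type u} [Field C]

theorem mul_prod_mem_solutionSpace {L M : DiffOp C} (hL : L ≠ 0) (hM : M ≠ 0) {ι : Type*}
    (s : Finset ι) (y : ι → LaurentSeries C) (hy : ∀ i ∈ s, y i ∈ solutionSpace L)
    {f : LaurentSeries C} (hf : f ∈ solutionSpace M) :
    f * ∏ i ∈ s, y i ∈ solutionSpace (symProduct M (symPower L s.card)).toDiffOp :=
  mul_mem_solutionSpace_symProduct hM (symPower_ne_zero hL _) hf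
    (prod_mem_solutionSpace_symPower hL s y hy)

/-- If `h gᵢ ∈ V(M)` for one of the solutions `g₁, …, gᵣ` of `L`, then `h g₁ ⋯ gᵣ` is a solution of
`M ⊗ L^{⊗ (r - 1)}`. -/
theorem mul_prod_univ_mem_solutionSpace {L M : DiffOp C} (hL : L ≠ 0) (hM : M ≠ 0) {r : ℕ}
    (g : Fin r → LaurentSeries C) (hg : ∀ i, g i ∈ solutionSpace L) (i : Fin r)
    {h : LaurentSeries C} (hh : h * g i ∈ solutionSpace M) :
    h * ∏ l, g l ∈ solutionSpace (symProduct M (symPower L (r - 1))).toDiffOp := by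
  -- `h gᵢ` serves as the factor from `V(M)`, the remaining `r - 1` series `gₗ` as those from
  -- `V(L)`.
  have h1 := mul_prod_mem_solutionSpace hL hM (Finset.univ.erase i) g (fun l _ => hg l) hh
  rwa [mul_assoc, Finset.mul_prod_erase _ _ (Finset.mem_univ i),
    Finset.card_erase_of_mem (Finset.mem_univ i), Finset.card_fin] at h1

theorem order_prod_univ {r : ℕ} {g : Fin r → LaurentSeries C}
    (hg : ∀ i, HasInitialTerm (g i) (i : ℕ)) :
    (∏ l, g l).order = ((r * (r - 1) / 2 : ℕ) : ℤ) := by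
  rw [order_prod _ _ fun i _ => (hg i).ne_zero, Finset.sum_congr rfl fun i _ => (hg i).order_eq,
    ← Nat.cast_sum, Fin.sum_univ_eq_sum_range (fun i => i) r, Finset.sum_range_id]

/-- Injectivity of the truncation `T_k` on differences of elements of the spaces `Wᵢ`. -/
theorem eq_zero_of_truncation_eq_zero {L M : DiffOp C} (hL : L ≠ 0) (hM : M ≠ 0) {r : ℕ}
    {g : Fin r → LaurentSeries C} (hg : ∀ i, HasInitialTerm (g i) (i : ℕ)) {m : ℕ}
    (hm : m ∈ upperBounds (symProduct M (symPower L (r - 1))).indicialRoots) {k : ℤ}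
    (hk : (m : ℤ) - ((r * (r - 1) / 2 : ℕ) : ℤ) < k) {h : LaurentSeries C}
    (hN : h * ∏ l, g l ∈ solutionSpace (symProduct M (symPower L (r - 1))).toDiffOp)
    (h0 : h ∈ powerSeriesSubspace C) (hT : truncation C k h = 0) : h = 0 := by
  by_contra hne
  have hP : ∏ l, g l ≠ 0 := Finset.prod_ne_zero_iff.mpr fun l _ => (hg l).ne_zero
  have h1 := HahnSeries.order_mul hne hP
  rw [order_prod_univ hg] at h1
  have h2 : 0 ≤ h.order := le_order_of_coeff_eq_zero hne h0
  have h3 : k + 1 ≤ h.order := le_order_of_coeff_eq_zero hne (truncation_eq_zero_iff.mp hT)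
  obtain ⟨v, hv⟩ := Int.eq_ofNat_of_zero_le (a := (h * ∏ l, g l).order) (by omega)
  -- The order of the product is at least `k + 1 + r(r-1)/2`, beyond the largest indicial root `m`.
  have h4 := hm (PolyDiffOp.order_mem_indicialRoots
    (symProduct_ne_zero hM (symPower_ne_zero hL _)) (mul_ne_zero hne hP) hN hv)
  omega

end SolutionProducts

theorem mainTheorem3 {C : Type u} [Field C] [IsAlgClosed C] [CharZero C]
    (L M : DiffOp C) (hL : 0 < L.natDegree) (hM : 0 < M.natDegree)
    (hL0 : IsOrdinaryAtZero L) (hM0 : IsOrdinaryAtZero M)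
    -- bases of `V(L)` and `V(M)`, indexed from `0`
    (g : Module.Basis (Fin L.natDegree) C (solutionSpace L))
    (hg : ∀ i, HasInitialTerm (g i : LaurentSeries C) (i : ℕ))
    (f : Module.Basis (Fin M.natDegree) C (solutionSpace M))
    (hf : ∀ j, HasInitialTerm (f j : LaurentSeries C) (j : ℕ))
    (W : Fin L.natDegree → Submodule C (LaurentSeries C))
    (hW : ∀ i, W i =
      colonSpace (solutionSpace M) {(g i : LaurentSeries C)} ⊓ powerSeriesSubspace C)
    (N : PolyDiffOp C) (hN : N = symProduct M (symPower L (L.natDegree - 1))) :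
    (∀ i, W i = Submodule.span C
      {h | ∃ j : Fin M.natDegree, (i : ℕ) ≤ (j : ℕ) ∧
        h = (f j : LaurentSeries C) / (g i : LaurentSeries C)}) ∧
    ∃ m : ℕ, IsGreatest N.indicialRoots m ∧
      ∀ k : ℤ, (m : ℤ) - ((L.natDegree * (L.natDegree - 1) / 2 : ℕ) : ℤ) < k →
        -- the truncated spaces are given by finitely many coefficients of the series
        (∀ i, (W i).map (truncation C k) = Submodule.span C
          {h | ∃ j : Fin M.natDegree, (i : ℕ) ≤ (j : ℕ) ∧
            h = truncation C k
              (truncation C (k + L.natDegree - 1) (f j : LaurentSeries C) /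
                truncation C (k + L.natDegree - 1) (g i : LaurentSeries C))}) ∧
        Module.rank C (colonSpace (solutionSpace M) (solutionSpace L : Set (LaurentSeries C))) =
          Module.rank C (⨅ i, (W i).map (truncation C k) : Submodule C (LaurentSeries C)) ∧
        (colonSpace (solutionSpace M) (solutionSpace L : Set (LaurentSeries C))).map
            (truncation C k) =
          ⨅ i, (W i).map (truncation C k) := by
  have hL' : L ≠ 0 := fun h => by simp [h] at hL
  have hM' : M ≠ 0 := fun h => by simp [h] at hM
  have hN' : N ≠ 0 := hN ▸ symProduct_ne_zero hM' (symPower_ne_zero hL' _)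
  have hspan : ∀ i, W i = Submodule.span C
      {h | ∃ j : Fin M.natDegree, (i : ℕ) ≤ (j : ℕ) ∧
        h = (f j : LaurentSeries C) / (g i : LaurentSeries C)} := fun i => by
    rw [hW, colonSpace_singleton_inf_powerSeriesSubspace f hf (hg i)]
  have hcolon : colonSpace (solutionSpace M) (solutionSpace L : Set (LaurentSeries C)) =
      ⨅ i, W i := by
    rw [colonSpace_eq_iInf hL f hf g hg]
    simp only [hW]
  -- the solution `f₁ gᵣ ^ (r - 1)` of `N` has order `(r - 1) ^ 2`
  have hsq : (L.natDegree - 1) * (L.natDegree - 1) ∈ N.indicialRoots := by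
    have hlast := hg ⟨L.natDegree - 1, by omega⟩
    set γ := (g ⟨L.natDegree - 1, by omega⟩ : LaurentSeries C)
    have hmem := mul_prod_mem_solutionSpace hL' hM' (Finset.range (L.natDegree - 1)) (fun _ => γ)
      (fun _ _ => (g ⟨L.natDegree - 1, by omega⟩).2) (f ⟨0, hM⟩).2
    rw [Finset.card_range, ← hN] at hmem
    have hne : ∏ i ∈ Finset.range (L.natDegree - 1), γ ≠ 0 :=
      Finset.prod_ne_zero_iff.mpr fun _ _ => hlast.ne_zero
    refine PolyDiffOp.order_mem_indicialRoots hN' (mul_ne_zero (hf ⟨0, hM⟩).ne_zero hne) hmem ?_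
    rw [HahnSeries.order_mul (hf ⟨0, hM⟩).ne_zero hne, order_prod _ _ fun _ _ => hlast.ne_zero,
      (hf ⟨0, hM⟩).order_eq, hlast.order_eq]
    simp
  have hfin := PolyDiffOp.finite_indicialRoots hN'
  obtain ⟨m, hm⟩ : ∃ m, IsGreatest N.indicialRoots m :=
    ⟨sSup N.indicialRoots, Nat.sSup_mem ⟨_, hsq⟩ hfin.bddAbove, fun _ h => le_csSup hfin.bddAbove h⟩
  refine ⟨hspan, m, hm, fun k hk => ?_⟩
  -- From `m ≥ (r-1)² ≥ r(r-1)/2` it follows that `k₀ ≥ 0`; the quotients of truncations below need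
  -- `k ≥ 0` to keep the initial term of each `gᵢ`.
  have hk0 : 0 ≤ k := by
    have h1 := hm.2 hsq
    have h2 : L.natDegree * (L.natDegree - 1) / 2 ≤ (L.natDegree - 1) * (L.natDegree - 1) := by
      obtain ⟨s, hs⟩ := Nat.exists_eq_succ_of_ne_zero hL.ne'
      rw [hs, Nat.succ_sub_one]
      refine Nat.div_le_of_le_mul ?_
      rcases Nat.eq_zero_or_pos s with rfl | hs
      · simp
      · nlinarith
    omega
  -- Allowing `i ≠ j` is essential: it makes the truncation commute with the intersection and not
  -- merely injective on each space.
  have hinj : ∀ i j, ∀ h₁ ∈ W i, ∀ h₂ ∈ W j, truncation C k h₁ = truncation C k h₂ → h₁ = h₂ := by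
    have hmul : ∀ i, ∀ h ∈ W i, h * ∏ l, (g l : LaurentSeries C) ∈ solutionSpace N.toDiffOp := by
      intro i h hh
      rw [hW] at hh
      rw [hN]
      exact mul_prod_univ_mem_solutionSpace hL' hM' _ (fun l => (g l).2) i
        (mem_colonSpace_singleton.mp hh.1)
    have hpow : ∀ i, W i ≤ powerSeriesSubspace C := fun i => by
      rw [hW]
      exact inf_le_right
    intro i j h₁ hh₁ h₂ hh₂ heq
    rw [← sub_eq_zero]
    subst hN
    refine eq_zero_of_truncation_eq_zero hL' hM' hg hm.2 hk ?_
      (Submodule.sub_mem _ (hpow i hh₁) (hpow j hh₂)) (by rw [map_sub, heq, sub_self])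
    rw [sub_mul]
    exact Submodule.sub_mem _ (hmul i h₁ hh₁) (hmul j h₂ hh₂)
  have hmap : (⨅ i, W i).map (truncation C k) = ⨅ i, (W i).map (truncation C k) := by
    apply le_antisymm
    · exact le_iInf fun i => Submodule.map_mono (iInf_le _ i)
    · intro t ht
      rw [Submodule.mem_iInf] at ht
      choose h hh htr using ht
      -- The preimages of `t` chosen in the various `W i` all coincide by `hinj`, so any one of them
      -- lies in the intersection.
      refine ⟨h ⟨0, hL⟩, Submodule.mem_iInf _ |>.mpr fun i => ?_, htr _⟩
      rw [hinj _ i _ (hh _) _ (hh i) ((htr _).trans (htr i).symm)]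
      exact hh i
  refine ⟨fun i => ?_, ?_, ?_⟩
  · rw [hspan, Submodule.map_span]
    congr 1
    ext t
    have hdiv : ∀ j : Fin M.natDegree, (i : ℕ) ≤ (j : ℕ) →
        truncation C k
          (truncation C (k + L.natDegree - 1) (f j : LaurentSeries C) /
            truncation C (k + L.natDegree - 1) (g i : LaurentSeries C)) =
        truncation C k ((f j : LaurentSeries C) / (g i : LaurentSeries C)) := fun j hij =>
      -- The index `i` starts at `0`, so `i ≤ r - 1` and the cut-off `k + r - 1` is at least `k +
      -- i`.
      truncation_div_truncation (fun s hs => (hf j).2 s (by omega)) (hg i) hk0 (by omega)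
    constructor
    · rintro ⟨_, ⟨j, hij, rfl⟩, rfl⟩
      exact ⟨j, hij, (hdiv j hij).symm⟩
    · rintro ⟨j, hij, rfl⟩
      exact ⟨_, ⟨j, hij, rfl⟩, (hdiv j hij).symm⟩
  · rw [hcolon, ← hmap, ← LinearMap.range_domRestrict]
    refine (LinearEquiv.ofInjective ((truncation C k).domRestrict (⨅ i, W i)) ?_).rank_eq
    rintro ⟨h₁, hh₁⟩ ⟨h₂, hh₂⟩ heq
    exact Subtype.ext (hinj ⟨0, hL⟩ ⟨0, hL⟩ h₁ (Submodule.mem_iInf _ |>.mp hh₁ _) h₂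
      (Submodule.mem_iInf _ |>.mp hh₂ _) heq)
  · rw [hcolon, hmap]
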